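/- Let $Q$ be a finite group acting by automorphisms on a group $G$, and let $A$ be an abelian group with trivial $G$- and $Q$-actions. Let $C_\bullet(G;A)$ be the (unnormalized) bar complex, $C_i(G;A)=\bigoplus_{(g_1,\dots,g_i)\in G^i} A\,[g_1|\cdots|g_i]$, with boundary $$d[g_1|\cdots|g_i]=[g_2|\cdots|g_i]+\sum_{j=1}^{i-1}(-1)^j[g_1|\cdots|g_jg_{j+1}|\cdots|g_i]+(-1)^i[g_1|\cdots|g_{i-1}]$$ and $Q$-action $q\cdot[g_1|\cdots|g_i]=[q(g_1)|\cdots|q(g_i)]$. Put $H^Q_\bullet(G;A)=h_\bullet\bigl(C_\bullet(G;A)^Q\bigr)$, the homology of the subcomplex of $Q$-invariant chains. The inclusion $C_\bullet(G;A)^Q\hookrightarrow C_\bullet(G;A)$ induces a natural map $i_*:H^Q_\bullet(G;A)\to H_\bullet(G;A)^Q$ into the subgroup of $Q$-invariant homology classes. **Theorem.** Let $n\ge 1$ be an integer with $n\not\equiv 0 \pmod 4$, and let $\mathbb Z/2$ act on $\mathbb Z/n$ by $x\mapsto -x$. Then in every degree $\ell\ge 0$ the natural map $$i_*:H_\ell^{\mathbb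 Z/2}(\mathbb Z/n;\mathbb Z)\longrightarrow H_\ell(\mathbb Z/n;\mathbb Z)^{\mathbb Z/2}$$ is an isomorphism. Explicitly, $H_0^{\mathbb Z/2}(\mathbb Z/n;\mathbb Z)\cong\mathbb Z$, and in degrees $\ell>0$: - if $n$ is odd, then $H_\ell^{\mathbb Z/2}(\mathbb Z/n;\mathbb Z)\cong\mathbb Z/n$ for $\ell=4k-1$ with $k\ge1$, and it is $0$ for all other $\ell>0$; - if $n=2k$ with $k$ odd, then $H_\ell^{\mathbb Z/2}(\mathbb Z/n;\mathbb Z)\cong\mathbb Z/2$ for $\ell=4s-3$ with $s\ge1$, $\;\cong\mathbb Z/2k$ for $\ell=4s-1$ with $s\ge1$, and it is $0$ for even $\ell>0$. -/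

import Mathlib

open CategoryTheory

noncomputable section

namespace InvariantChains

section General

variable {Q G : Type} [Group Q] [Group G] (φ : Q →* MulAut G)
  (k : Type) [CommRing k] (A : Type) [AddCommGroup A] [Module k A]

/-- The (unnormalized) bar complex `C_•(G; A)`, with `A` a `k`-module (an abelian group
for `k = ℤ`) on which `G` acts trivially: its group in degree `i` is `(Fin i → G) →₀ A`, the element `[g₁|⋯|gᵢ] ⊗ a` being `Finsupp.single g a`. -/
abbrev barChains (k : Type) [CommRing k] (G : Type) [Group G]
    (A : Type) [AddCommGroup A] [Module k A] :
    ChainComplex (ModuleCat k) ℕ :=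
  groupHomology.inhomogeneousChains (Rep.trivial k G A)

/-- The homology `H_i(G; A)` of a group with trivial coefficients. -/
abbrev barHomology (k : Type) [CommRing k] (G : Type) [Group G]
    (A : Type) [AddCommGroup A] [Module k A] (i : ℕ) : ModuleCat k :=
  groupHomology (Rep.trivial k G A) i

/-- The action of `q : Q` on the bar complex, induced by the automorphism `φ q` of `G`. -/
def chainAction (q : Q) : barChains k G A ⟶ barChains k G A :=
  groupHomology.chainsMap (A := Rep.trivial k G A) (B := Rep.trivial k G A)
    (φ q).toMonoidHom (𝟙 (Rep.trivial k G A))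

/-- `q ([g₁|⋯|gᵢ] ⊗ a) = [q g₁|⋯|q gᵢ] ⊗ a`. -/
theorem chainAction_single (q : Q) (i : ℕ) (g : Fin i → G) (a : A) :
    ((chainAction φ k A q).f i).hom (Finsupp.single g a : (Fin i → G) →₀ A) =
      (Finsupp.single (fun j => φ q (g j)) a : (Fin i → G) →₀ A) :=
  groupHomology.chainsMap_f_single (A := Rep.trivial k G A) (B := Rep.trivial k G A)
    (φ q).toMonoidHom (𝟙 (Rep.trivial k G A)) i g a

/-- The group `C_i(G; A)^Q` of invariant chains. -/
def invariantChains (i : ℕ) : Submodule k ((barChains k G A).X i) where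
  carrier := {c | ∀ q : Q, ((chainAction φ k A q).f i).hom c = c}
  zero_mem' := fun _ => map_zero _
  add_mem' := fun ha hb q => by rw [map_add, ha q, hb q]
  smul_mem' := fun r a ha q => by rw [map_smul, ha q]

theorem d_mem_invariantChains (i j : ℕ) (c : (barChains k G A).X i)
    (hc : c ∈ invariantChains φ k A i) :
    ((barChains k G A).d i j).hom c ∈ invariantChains φ k A j := by
  intro q
  have h : ((barChains k G A).d i j).hom (((chainAction φ k A q).f i).hom c) =
      ((chainAction φ k A q).f j).hom (((barChains k G A).d i j).hom c) :=
    congrArg (fun f => f.hom c) ((chainAction φ k A q).comm i j)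
  rw [hc q] at h
  exact h.symm

/-- The subcomplex `C_•(G; A)^Q` of invariant chains. -/
def invariantComplex : ChainComplex (ModuleCat k) ℕ where
  X i := ModuleCat.of k (invariantChains φ k A i)
  d i j := ModuleCat.ofHom
    (((barChains k G A).d i j).hom.restrict (d_mem_invariantChains φ k A i j))
  shape i j h := by
    refine ModuleCat.hom_ext (LinearMap.ext fun x => Subtype.ext ?_)
    exact congrArg (fun f => f.hom (x : (barChains k G A).X i)) ((barChains k G A).shape i j h)
  d_comp_d' i j l _ _ := by
    refine ModuleCat.hom_ext (LinearMap.ext fun x => Subtype.ext ?_)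
    exact congrArg (fun f => f.hom (x : (barChains k G A).X i)) ((barChains k G A).d_comp_d i j l)

/-- The inclusion of complexes `C_•(G; A)^Q ⟶ C_•(G; A)`. -/
def inclusion : invariantComplex φ k A ⟶ barChains k G A where
  f i := ModuleCat.ofHom (invariantChains φ k A i).subtype
  comm' _ _ _ := rfl

/-- The homology of invariant group chains, `H_i^Q(G; A) = h_i (C_•(G; A)^Q)`. -/
abbrev invariantHomology (i : ℕ) : ModuleCat k := (invariantComplex φ k A).homology i

/-- The action of `q : Q` on `H_i(G; A)`. -/
def homologyAction (q : Q) (i : ℕ) : barHomology k G A i ⟶ barHomology k G A i :=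
  HomologicalComplex.homologyMap (chainAction φ k A q) i

/-- The subgroup `H_i(G; A)^Q` of invariant homology classes. -/
def homologyInvariants (i : ℕ) : Submodule k (barHomology k G A i) where
  carrier := {x | ∀ q : Q, (homologyAction φ k A q i).hom x = x}
  zero_mem' := fun _ => map_zero _
  add_mem' := fun ha hb q => by rw [map_add, ha q, hb q]
  smul_mem' := fun r a ha q => by rw [map_smul, ha q]

/-- The map `H_i^Q(G; A) ⟶ H_i(G; A)` induced by the inclusion of complexes. -/
def inclusionHomology (i : ℕ) : invariantHomology φ k A i ⟶ barHomology k G A i :=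
  HomologicalComplex.homologyMap (inclusion φ k A) i

theorem inclusion_comp_chainAction (q : Q) :
    inclusion φ k A ≫ chainAction φ k A q = inclusion φ k A := by
  refine HomologicalComplex.hom_ext _ _ fun i => ModuleCat.hom_ext (LinearMap.ext fun x => ?_)
  exact x.2 q

theorem inclusionHomology_mem (i : ℕ) (x : invariantHomology φ k A i) :
    (inclusionHomology φ k A i).hom x ∈ homologyInvariants φ k A i := by
  intro q
  have h : inclusionHomology φ k A i ≫ homologyAction φ k A q i = inclusionHomology φ k A i :=
    (HomologicalComplex.homologyMap_comp (inclusion φ k A) (chainAction φ k A q) i).symm.trans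
      (congrArg (fun f => HomologicalComplex.homologyMap f i) (inclusion_comp_chainAction φ k A q))
  exact congrArg (fun f => f.hom x) h

/-- The natural map `i_* : H_i^Q(G; A) → H_i(G; A)^Q`. -/
def naturalMap (i : ℕ) : invariantHomology φ k A i →ₗ[k] homologyInvariants φ k A i :=
  (inclusionHomology φ k A i).hom.codRestrict _ (inclusionHomology_mem φ k A i)

end General

/-- The action of `ℤ/2` on `ℤ/n` by negation (both groups written multiplicatively): the
trivial element acts as the identity, the nontrivial one by `x ↦ -x`. -/
def negation (n : ℕ) : Multiplicative (ZMod 2) →* MulAut (Multiplicative (ZMod n)) where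
  toFun q := if q = 1 then 1 else MulEquiv.inv (Multiplicative (ZMod n))
  map_one' := if_pos rfl
  map_mul' a b := by
    have h : ∀ a b : Multiplicative (ZMod 2), (a = 1 ∧ b = 1 ∧ a * b = 1) ∨
        (a = 1 ∧ b ≠ 1 ∧ a * b ≠ 1) ∨ (a ≠ 1 ∧ b = 1 ∧ a * b ≠ 1) ∨
        (a ≠ 1 ∧ b ≠ 1 ∧ a * b = 1) := by decide
    ext x
    rcases h a b with ⟨h1, h2, h3⟩ | ⟨h1, h2, h3⟩ | ⟨h1, h2, h3⟩ | ⟨h1, h2, h3⟩ <;>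
      simp [h1, h2, h3]

theorem negation_ofAdd_one (n : ℕ) (x : ZMod n) :
    negation n (Multiplicative.ofAdd 1) (Multiplicative.ofAdd x) = Multiplicative.ofAdd (-x) :=
  rfl

end InvariantChains

end

/-! Write the cyclic group multiplicatively. Since `4 ∤ n`, there is an odd `m` with `n ∣ 2m`. The
power map `r(g) = g ^ m` then takes values of order at most two, which negation fixes, and `P = ker
r` has odd order. Moreover `g * (r g)⁻¹ ∈ P`, so `r` retracts the group onto its 2-torsion along
cosets of `P`.

A prism operator that inserts a sum over `P` gives `d h + h d = |P| (1 - r)` (`barDiff_prism_add`).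
It is equivariant because negation preserves `P` and commutes with `r`. Thus, up to the odd factor
`|P|`, every cycle is equivariantly homologous to an invariant one; orbit sums give the same up to
the factor `|Q| = 2`. The two factors are coprime, so the kernel and cokernel of `i_*` vanish
(`naturalMap_bijective_of_homotopy`).

It remains to find the invariant classes. The periodic resolution gives `H_l = 0` for even `l > 0`
and order `n` for odd `l`. For the action in degree `2i + 1`, classes are paired with `f ^ i ∪ e`,
where `f` is the carry cocycle and `e` the identity `ℤ/n → ℤ/n`. Negation sends `e` to `-e` and `f`
to `-f` modulo a coboundary, hence acts by `(-1) ^ (i + 1)` (`exists_barHomology_odd_equiv`). All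
classes are invariant for odd `i`, and only the 2-torsion for even `i`. -/

noncomputable section

namespace InvariantChains

/-! ### Homology classes of explicit cycles -/

section Classes

variable {R : Type} [CommRing R] (K L : ChainComplex (ModuleCat R) ℕ)

/-- The cycles of a complex of modules, as elements of the module of chains. -/
def cycleSubmodule (l : ℕ) : Submodule R (K.X l) :=
  LinearMap.ker (K.d l ((ComplexShape.down ℕ).next l)).hom

theorem mem_cycleSubmodule_zero (z : K.X 0) : z ∈ cycleSubmodule K 0 := by
  simp [cycleSubmodule]

theorem mem_cycleSubmodule_succ {l : ℕ} {z : K.X (l + 1)} :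
    z ∈ cycleSubmodule K (l + 1) ↔ (K.d (l + 1) l).hom z = 0 := by
  have h : (ComplexShape.down ℕ).next (l + 1) = l := ChainComplex.next_nat_succ l
  rw [cycleSubmodule, LinearMap.mem_ker, h]

variable {K L} in
theorem map_mem_cycleSubmodule (f : K ⟶ L) {l : ℕ} {z : K.X l} (hz : z ∈ cycleSubmodule K l) :
    (f.f l).hom z ∈ cycleSubmodule L l := by
  have h := congrArg (fun f => f.hom z) (f.comm l ((ComplexShape.down ℕ).next l))
  have h2 : (K.d l ((ComplexShape.down ℕ).next l)).hom z = 0 := hz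
  simp only [ModuleCat.hom_comp, LinearMap.comp_apply, h2, map_zero] at h
  exact h

/-- A cycle, as an element of the object of cycles. -/
def toCycles (l : ℕ) : cycleSubmodule K l →ₗ[R] K.cycles l :=
  ((K.sc l).moduleCatCyclesIso.inv).hom

theorem iCycles_toCycles (l : ℕ) (z : cycleSubmodule K l) :
    (K.iCycles l).hom (toCycles K l z) = z.1 :=
  congrArg (fun f => f.hom z) (K.sc l).moduleCatCyclesIso_inv_iCycles

theorem iCycles_injective (l : ℕ) : Function.Injective (K.iCycles l).hom :=
  (ModuleCat.mono_iff_injective _).1 inferInstance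

/-- The homology class of a cycle. -/
def homologyClass (l : ℕ) : cycleSubmodule K l →ₗ[R] K.homology l :=
  (K.homologyπ l).hom ∘ₗ toCycles K l

theorem homologyClass_apply (l : ℕ) (z : cycleSubmodule K l) :
    homologyClass K l z = (K.homologyπ l).hom (toCycles K l z) :=
  rfl

theorem homologyClass_surjective (l : ℕ) : Function.Surjective (homologyClass K l) := by
  refine Function.Surjective.comp (g := (K.homologyπ l).hom) ?_ ?_
  · exact (ModuleCat.epi_iff_surjective _).1 inferInstance
  · exact (ModuleCat.epi_iff_surjective _).1
      (inferInstanceAs (Epi (K.sc l).moduleCatCyclesIso.inv))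

/-- Homology is the cokernel of the differential into the cycles, and cycles embed in chains. -/
theorem homologyClass_eq_zero_iff {l : ℕ} (z : cycleSubmodule K l) :
    homologyClass K l z = 0 ↔ ∃ w : K.X (l + 1), (K.d (l + 1) l).hom w = z.1 := by
  have hprev : (ComplexShape.down ℕ).prev l = l + 1 := ChainComplex.prev ℕ l
  have hex : (ShortComplex.mk (K.toCycles (l + 1) l) (K.homologyπ l) (by simp)).Exact :=
    ShortComplex.exact_of_g_is_cokernel _ (K.homologyIsCokernel (l + 1) l hprev)
  have hcomp (w : K.X (l + 1)) :
      (K.iCycles l).hom ((K.toCycles (l + 1) l).hom w) = (K.d (l + 1) l).hom w :=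
    congrArg (fun f => f.hom w) (K.toCycles_i (l + 1) l)
  rw [ShortComplex.moduleCat_exact_iff] at hex
  constructor
  · intro h
    obtain ⟨w, hw⟩ := hex _ h
    refine ⟨w, ?_⟩
    rw [← hcomp, ← iCycles_toCycles]
    exact congrArg (K.iCycles l).hom hw
  · rintro ⟨w, hw⟩
    have h1 : toCycles K l z = (K.toCycles (l + 1) l).hom w := by
      apply iCycles_injective
      rw [hcomp, hw, iCycles_toCycles]
    have h2 : K.toCycles (l + 1) l ≫ K.homologyπ l = 0 := by simp
    rw [homologyClass_apply, h1]
    exact congrArg (fun f => f.hom w) h2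

variable {K L} in
theorem homologyMap_homologyClass (f : K ⟶ L) {l : ℕ} (z : cycleSubmodule K l) :
    (HomologicalComplex.homologyMap f l).hom (homologyClass K l z) =
      homologyClass L l ⟨(f.f l).hom z.1, map_mem_cycleSubmodule f z.2⟩ := by
  have h1 : (HomologicalComplex.cyclesMap f l).hom (toCycles K l z) =
      toCycles L l ⟨(f.f l).hom z.1, map_mem_cycleSubmodule f z.2⟩ := by
    apply iCycles_injective
    rw [iCycles_toCycles]
    refine (congrArg (fun g => g.hom (toCycles K l z))
      (HomologicalComplex.cyclesMap_i f l)).trans ?_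
    exact congrArg (f.f l).hom (iCycles_toCycles K l z)
  rw [homologyClass_apply, homologyClass_apply, ← h1]
  exact congrArg (fun g => g.hom (toCycles K l z)) (HomologicalComplex.homologyπ_naturality f l)

end Classes

/-! ### Invariant chains versus invariant classes -/

section Comparison

variable {Q G : Type} [Group Q] [Group G] (φ : Q →* MulAut G)
  (k : Type) [CommRing k] (A : Type) [AddCommGroup A] [Module k A]

theorem chainAction_apply (q : Q) (l : ℕ) (c : (Fin l → G) →₀ A) :
    ((chainAction φ k A q).f l).hom c = c.mapDomain fun g j => φ q (g j) := by
  let F : ((Fin l → G) →₀ A) →ₗ[k] ((Fin l → G) →₀ A) := ((chainAction φ k A q).f l).hom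
  have h : F = Finsupp.lmapDomain A k fun g j => φ q (g j) :=
    Finsupp.lhom_ext fun g a => (chainAction_single φ k A q l g a).trans
      (Finsupp.mapDomain_single (f := fun (g : Fin l → G) j => φ q (g j))).symm
  exact LinearMap.congr_fun h c

theorem chainAction_mul_apply (p q : Q) (l : ℕ) (c : (barChains k G A).X l) :
    ((chainAction φ k A (p * q)).f l).hom c =
      ((chainAction φ k A p).f l).hom (((chainAction φ k A q).f l).hom c) := by
  refine (chainAction_apply φ k A (p * q) l c).trans (Eq.symm ?_)
  refine (congrArg ((chainAction φ k A p).f l).hom (chainAction_apply φ k A q l c)).trans ?_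
  refine (chainAction_apply φ k A p l _).trans ?_
  rw [← Finsupp.mapDomain_comp]
  congr 1
  funext g j
  simp

theorem d_chainAction (q : Q) (i j : ℕ) (c : (barChains k G A).X i) :
    ((barChains k G A).d i j).hom (((chainAction φ k A q).f i).hom c) =
      ((chainAction φ k A q).f j).hom (((barChains k G A).d i j).hom c) :=
  congrArg (fun f => f.hom c) ((chainAction φ k A q).comm i j)

theorem mem_cycleSubmodule_invariantComplex {l : ℕ} {z : (barChains k G A).X l}
    (hz : z ∈ cycleSubmodule (barChains k G A) l) (hi : z ∈ invariantChains φ k A l) :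
    (⟨z, hi⟩ : invariantChains φ k A l) ∈ cycleSubmodule (invariantComplex φ k A) l :=
  Subtype.ext hz

theorem inclusionHomology_homologyClass {l : ℕ} (z : cycleSubmodule (invariantComplex φ k A) l) :
    (inclusionHomology φ k A l).hom (homologyClass _ l z) =
      homologyClass (barChains k G A) l
        ⟨z.1.1, map_mem_cycleSubmodule (inclusion φ k A) z.2⟩ :=
  homologyMap_homologyClass (inclusion φ k A) z

theorem homologyAction_homologyClass (q : Q) {l : ℕ}
    (z : cycleSubmodule (barChains k G A) l) :
    (homologyAction φ k A q l).hom (homologyClass (barChains k G A) l z) =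
      homologyClass (barChains k G A) l
        ⟨((chainAction φ k A q).f l).hom z.1, map_mem_cycleSubmodule (chainAction φ k A q) z.2⟩ :=
  homologyMap_homologyClass (chainAction φ k A q) z

variable [Fintype Q]

theorem sum_chainAction_mem_invariantChains {l : ℕ} (c : (barChains k G A).X l) :
    ∑ q : Q, ((chainAction φ k A q).f l).hom c ∈ invariantChains φ k A l := by
  intro p
  rw [map_sum]
  exact Fintype.sum_equiv (Equiv.mulLeft p) _ _ fun q =>
    (chainAction_mul_apply φ k A p q l c).symm

theorem sum_chainAction_of_mem_invariantChains {l : ℕ} {c : (barChains k G A).X l}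
    (hc : c ∈ invariantChains φ k A l) :
    ∑ q : Q, ((chainAction φ k A q).f l).hom c = Fintype.card Q • c := by
  rw [Finset.sum_congr rfl fun q _ => hc q]
  simp

variable {M : Type} [AddCommGroup M] in
theorem eq_zero_of_coprime_nsmul {a b : ℕ} (hab : a.Coprime b) {x : M} (ha : a • x = 0)
    (hb : b • x = 0) : x = 0 := by
  have h := Nat.dvd_gcd (addOrderOf_dvd_of_nsmul_eq_zero ha) (addOrderOf_dvd_of_nsmul_eq_zero hb)
  rw [hab.gcd_eq_one, Nat.dvd_one, AddMonoid.addOrderOf_eq_one_iff] at h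
  exact h

variable {M : Type} [AddCommGroup M] in
theorem mem_of_coprime_nsmul_mem {a b : ℕ} (hab : a.Coprime b) (N : AddSubgroup M) {x : M}
    (ha : a • x ∈ N) (hb : b • x ∈ N) : x ∈ N := by
  rw [← QuotientAddGroup.eq_zero_iff] at ha hb ⊢
  exact eq_zero_of_coprime_nsmul hab ha hb

/-- If a chain endomorphism `r` with invariant values is homotopic to the identity up to a factor
`m` prime to the order of `Q`, by an equivariant homotopy, then invariant chains compute
invariant homology classes. -/
theorem naturalMap_bijective_of_homotopy {m : ℕ} (hm : m.Coprime (Fintype.card Q))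
    (r : barChains k G A ⟶ barChains k G A)
    (hr : ∀ l c, (r.f l).hom c ∈ invariantChains φ k A l)
    (h : ∀ l, (barChains k G A).X l → (barChains k G A).X (l + 1))
    (hh : ∀ l q c, ((chainAction φ k A q).f (l + 1)).hom (h l c) =
      h l (((chainAction φ k A q).f l).hom c))
    (hd : ∀ l, ∀ c ∈ cycleSubmodule (barChains k G A) l,
      ((barChains k G A).d (l + 1) l).hom (h l c) = m • (c - (r.f l).hom c)) (l : ℕ) :
    Function.Bijective (naturalMap φ k A l) := by
  have hrd (w : (barChains k G A).X (l + 1)) :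
      ((barChains k G A).d (l + 1) l).hom ((r.f (l + 1)).hom w) =
        (r.f l).hom (((barChains k G A).d (l + 1) l).hom w) :=
    congrArg (fun f => f.hom w) (r.comm (l + 1) l)
  constructor
  · rw [injective_iff_map_eq_zero]
    intro x hx
    obtain ⟨z, rfl⟩ := homologyClass_surjective _ _ x
    have hx' : (inclusionHomology φ k A l).hom (homologyClass _ l z) = 0 := congrArg Subtype.val hx
    obtain ⟨w, hw⟩ := (homologyClass_eq_zero_iff _ _).1
      ((inclusionHomology_homologyClass φ k A z).symm.trans hx')
    refine eq_zero_of_coprime_nsmul hm ?_ ?_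
    · rw [← map_nsmul, homologyClass_eq_zero_iff]
      -- With `z = d w`: `d (h z) = m (z - r z)` and `d (m r w) = m r z`, so the sum bounds `m z`.
      -- Both terms are invariant, the first because `z` is and `h` is equivariant.
      refine ⟨⟨h l z.1.1 + m • (r.f (l + 1)).hom w,
        add_mem (fun q => ?_) (nsmul_mem (hr _ _) _)⟩, Subtype.ext ?_⟩
      · rw [hh, z.1.2 q]
      · change ((barChains k G A).d (l + 1) l).hom (h l z.1.1 + m • (r.f (l + 1)).hom w) =
          m • z.1.1
        rw [map_add, map_nsmul, hrd, hw, hd l z.1.1 (map_mem_cycleSubmodule (inclusion φ k A) z.2),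
          smul_sub, sub_add_cancel]
    -- The orbit sum of `w` bounds the orbit sum of `z`, which is `|Q| z`.
    · rw [← map_nsmul, homologyClass_eq_zero_iff]
      refine ⟨⟨_, sum_chainAction_mem_invariantChains φ k A w⟩, Subtype.ext ?_⟩
      change ((barChains k G A).d (l + 1) l).hom (∑ q : Q, ((chainAction φ k A q).f (l + 1)).hom w)
        = Fintype.card Q • z.1.1
      rw [map_sum, ← sum_chainAction_of_mem_invariantChains φ k A z.1.2]
      refine Finset.sum_congr rfl fun q _ => ?_
      rw [d_chainAction, hw]
  · rintro ⟨y, hy⟩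
    suffices hmem : y ∈ (LinearMap.range (inclusionHomology φ k A l).hom).toAddSubgroup by
      obtain ⟨x, hx⟩ := hmem
      exact ⟨x, Subtype.ext hx⟩
    obtain ⟨z, rfl⟩ := homologyClass_surjective _ _ y
    refine mem_of_coprime_nsmul_mem hm _ ?_ ?_
    -- The invariant cycle `m r z` represents `m [z]`, the difference being the boundary of `-h z`.
    · have hz := nsmul_mem (map_mem_cycleSubmodule r z.2) m
      refine ⟨homologyClass _ l ⟨⟨_, nsmul_mem (hr l z.1) m⟩,
        mem_cycleSubmodule_invariantComplex φ k A hz _⟩, ?_⟩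
      refine (inclusionHomology_homologyClass φ k A _).trans ?_
      change homologyClass _ l ⟨m • (r.f l).hom z.1, hz⟩ = m • homologyClass _ l z
      rw [← map_nsmul (homologyClass (barChains k G A) l), ← sub_eq_zero, ← map_sub]
      refine (homologyClass_eq_zero_iff _ _).2 ⟨- h l z.1, ?_⟩
      rw [map_neg, hd l z.1 z.2, smul_sub, neg_sub]
      rfl
    -- Since `[z]` is invariant, the orbit sum of `z` represents `|Q| [z]`.
    · have hz : ∑ q : Q, ((chainAction φ k A q).f l).hom z.1 ∈
          cycleSubmodule (barChains k G A) l :=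
        sum_mem fun q _ => map_mem_cycleSubmodule (chainAction φ k A q) z.2
      refine ⟨homologyClass _ l ⟨⟨_, sum_chainAction_mem_invariantChains φ k A z.1⟩,
        mem_cycleSubmodule_invariantComplex φ k A hz _⟩, ?_⟩
      rw [inclusionHomology_homologyClass]
      calc homologyClass (barChains k G A) l ⟨∑ q : Q, ((chainAction φ k A q).f l).hom z.1, hz⟩
          = ∑ q : Q, homologyClass (barChains k G A) l ⟨((chainAction φ k A q).f l).hom z.1,
              map_mem_cycleSubmodule (chainAction φ k A q) z.2⟩ := by
            rw [← map_sum]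
            congr 1
            exact Subtype.ext (by simp)
        _ = ∑ q : Q, homologyClass (barChains k G A) l z :=
            Finset.sum_congr rfl fun q _ => by rw [← homologyAction_homologyClass]; exact hy q
        _ = Fintype.card Q • homologyClass (barChains k G A) l z := by simp

end Comparison

/-- Integral bar chains of degree `l`. -/
abbrev IntChains (G : Type) (l : ℕ) : Type := (Fin l → G) →₀ ℤ

/-! ### Recursion on the first entry of a bar chain -/

section Operators

variable {G H : Type}

/-- `c ↦ [x | c]`. -/
def consChain (x : G) (l : ℕ) : IntChains G l →ₗ[ℤ] IntChains G (l + 1) :=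
  Finsupp.lmapDomain ℤ ℤ (Fin.cons (α := fun _ => G) x)

/-- `[g₁ | g₂ | ⋯] ↦ [g₂ | ⋯]`. -/
def tailChain (G : Type) (l : ℕ) : IntChains G (l + 1) →ₗ[ℤ] IntChains G l :=
  Finsupp.lmapDomain ℤ ℤ (Fin.tail (α := fun _ => G))

/-- `[g₁ | g₂ | ⋯] ↦ [f g₁ | f g₂ | ⋯]`. -/
def pushChain (f : G → H) (l : ℕ) : IntChains G l →ₗ[ℤ] IntChains H l :=
  Finsupp.lmapDomain ℤ ℤ fun g j => f (g j)

/-- `[g₁ | g₂ | ⋯] ↦ [x g₁ | g₂ | ⋯]`. -/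
def mulHeadChain [Mul G] (x : G) (l : ℕ) : IntChains G (l + 1) →ₗ[ℤ] IntChains G (l + 1) :=
  Finsupp.lmapDomain ℤ ℤ fun g => Fin.cons (α := fun _ => G) (x * g 0) (Fin.tail g)

/-- The sum of the chains `[x | c]` with `x` in a finite set. -/
def sumConsChain (P : Finset G) (l : ℕ) : IntChains G l →ₗ[ℤ] IntChains G (l + 1) :=
  ∑ x ∈ P, consChain x l

/-- The bar differential. -/
def barDiff (G : Type) [Group G] (l : ℕ) : IntChains G (l + 1) →ₗ[ℤ] IntChains G l :=
  (groupHomology.inhomogeneousChains.d (Rep.trivial ℤ G ℤ) l).hom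

theorem consChain_single (x : G) (l : ℕ) (g : Fin l → G) (a : ℤ) :
    consChain x l (Finsupp.single g a) =
      Finsupp.single (Fin.cons (α := fun _ => G) x g) a := by
  simp [consChain]

theorem sumConsChain_apply (P : Finset G) (l : ℕ) (c : IntChains G l) :
    sumConsChain P l c = ∑ x ∈ P, consChain x l c := by
  simp [sumConsChain]

theorem hom_ext_consChain {M : Type} [AddCommGroup M] {l : ℕ}
    {f f' : IntChains G (l + 1) →ₗ[ℤ] M}
    (h : ∀ x c, f (consChain x l c) = f' (consChain x l c)) : f = f' := by
  refine Finsupp.lhom_ext fun g a => ?_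
  have := h (g 0) (Finsupp.single (Fin.tail g) a)
  rwa [consChain_single, Fin.cons_self_tail] at this

theorem tailChain_consChain (x : G) (l : ℕ) (c : IntChains G l) :
    tailChain G l (consChain x l c) = c := by
  simp only [tailChain, consChain, Finsupp.lmapDomain_apply, ← Finsupp.mapDomain_comp]
  exact Finsupp.mapDomain_id

theorem pushChain_consChain (f : G → H) (x : G) (l : ℕ) (c : IntChains G l) :
    pushChain f (l + 1) (consChain x l c) = consChain (f x) l (pushChain f l c) := by
  simp only [pushChain, consChain, Finsupp.lmapDomain_apply, ← Finsupp.mapDomain_comp]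
  congr 1
  funext g j
  refine Fin.cases ?_ (fun j => ?_) j <;> simp

theorem mulHeadChain_consChain [Mul G] (x y : G) (l : ℕ) (c : IntChains G l) :
    mulHeadChain x l (consChain y l c) = consChain (x * y) l c := by
  simp only [mulHeadChain, consChain, Finsupp.lmapDomain_apply, ← Finsupp.mapDomain_comp]
  congr 1

theorem barDiff_single [Group G] (l : ℕ) (g : Fin (l + 1) → G) (a : ℤ) :
    barDiff G l (Finsupp.single g a) = Finsupp.single (Fin.tail g) a +
      ∑ j : Fin (l + 1), (-1 : ℤ) ^ ((j : ℕ) + 1) •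
        Finsupp.single (Fin.contractNth j (· * ·) g) a :=
  groupHomology.inhomogeneousChains.d_single (A := Rep.trivial ℤ G ℤ) l g a

theorem contractNth_zero_cons [Mul G] {l : ℕ} (x : G) (g : Fin (l + 1) → G) :
    Fin.contractNth (0 : Fin (l + 2)) (· * ·) (Fin.cons (α := fun _ => G) x g) =
      Fin.cons (α := fun _ => G) (x * g 0) (Fin.tail g) := by
  funext i
  refine Fin.cases ?_ (fun i => ?_) i
  · simp [Fin.contractNth]
  · simp [Fin.contractNth, Fin.tail]

theorem contractNth_succ_cons [Mul G] {l : ℕ} (j : Fin (l + 1)) (x : G) (g : Fin (l + 1) → G) :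
    Fin.contractNth j.succ (· * ·) (Fin.cons (α := fun _ => G) x g) =
      Fin.cons (α := fun _ => G) x (Fin.contractNth j (· * ·) g) := by
  funext i
  refine Fin.cases ?_ (fun i => ?_) i
  · simp [Fin.contractNth]
  · simp only [Fin.contractNth, Fin.cons_succ, Fin.val_succ, add_lt_add_iff_right,
      add_left_inj, Fin.castSucc_succ]

theorem barDiff_zero [Group G] (c : IntChains G 1) : barDiff G 0 c = 0 := by
  suffices h : barDiff G 0 = 0 by rw [h, LinearMap.zero_apply]
  refine Finsupp.lhom_ext fun g a => ?_
  rw [barDiff_single]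
  simp [Subsingleton.elim (Fin.contractNth 0 _ g) (Fin.tail g)]

/-- The faces of `[x|c]` drop `x`, merge `x` into `c`, or act inside `c`; the last kind are the
faces of `c` other than its first, `tailChain`. -/
theorem barDiff_consChain [Group G] (x : G) (l : ℕ) (c : IntChains G (l + 1)) :
    barDiff G (l + 1) (consChain x (l + 1) c) =
      c - mulHeadChain x l c - consChain x l (barDiff G l c - tailChain G l c) := by
  induction c using Finsupp.induction_linear with
  | zero => simp
  | add f g hf hg => simp only [map_add, hf, hg]; simp only [map_sub, map_add]; abel
  | single g a =>
    rw [consChain_single, barDiff_single, barDiff_single, Fin.sum_univ_succ,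
      contractNth_zero_cons]
    simp only [contractNth_succ_cons, tailChain, mulHeadChain, Finsupp.lmapDomain_apply,
      Finsupp.mapDomain_single, add_sub_cancel_left, map_sum, map_smul, consChain_single]
    simp [pow_succ, sub_eq_add_neg, add_assoc, Fin.tail_cons]

end Operators

/-! ### The prism operator and its equivariance -/

section Prism

variable {G : Type} (P : Finset G) (r : G → G)

/-- The prism operator `[g₁|⋯|gₗ] ↦ ∑ⱼ (-1)ʲ ∑ₓ [r g₁|⋯|r gⱼ|x|gⱼ₊₁|⋯|gₗ]`, the inner sum
being over `x ∈ P`. -/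
def prism : ∀ l : ℕ, IntChains G l →ₗ[ℤ] IntChains G (l + 1)
  | 0 => sumConsChain P 0
  | l + 1 => sumConsChain P (l + 1) - Finsupp.lsum ℤ fun g : Fin (l + 1) → G =>
      consChain (r (g 0)) (l + 1) ∘ₗ prism l ∘ₗ Finsupp.lsingle (Fin.tail g)

theorem prism_zero : prism P r 0 = sumConsChain P 0 := rfl

theorem prism_consChain (x : G) (l : ℕ) (c : IntChains G l) :
    prism P r (l + 1) (consChain x l c) =
      sumConsChain P (l + 1) (consChain x l c) - consChain (r x) (l + 1) (prism P r l c) := by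
  induction c using Finsupp.induction_linear with
  | zero => simp
  | add f g hf hg => simp only [map_add, hf, hg]; abel
  | single g a =>
    rw [consChain_single, prism, LinearMap.sub_apply]
    simp

theorem pushChain_sumConsChain {f : G → G} (hf : Set.BijOn f P P) (l : ℕ) (c : IntChains G l) :
    pushChain f (l + 1) (sumConsChain P l c) = sumConsChain P l (pushChain f l c) := by
  simp only [sumConsChain_apply, map_sum, pushChain_consChain]
  exact Finset.sum_nbij f hf.mapsTo hf.injOn hf.surjOn fun _ _ => rfl

theorem pushChain_prism {f : G → G} (hf : Set.BijOn f P P) (hfr : ∀ g, f (r g) = r (f g)) (l : ℕ)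
    (c : IntChains G l) :
    pushChain f (l + 1) (prism P r l c) = prism P r l (pushChain f l c) := by
  induction l with
  | zero => exact pushChain_sumConsChain P hf 0 c
  | succ l ih =>
    suffices h : pushChain f (l + 2) ∘ₗ prism P r (l + 1) =
        prism P r (l + 1) ∘ₗ pushChain f (l + 1) from LinearMap.congr_fun h c
    refine hom_ext_consChain fun x c => ?_
    simp only [LinearMap.comp_apply, prism_consChain, pushChain_consChain, map_sub,
      pushChain_sumConsChain P hf, ih, hfr]

theorem tailChain_sumConsChain (l : ℕ) (c : IntChains G l) :
    tailChain G l (sumConsChain P l c) = P.card • c := by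
  simp [sumConsChain_apply, tailChain_consChain]

theorem tailChain_prism (l : ℕ) (c : IntChains G (l + 1)) :
    tailChain G (l + 1) (prism P r (l + 1) c) =
      P.card • c - prism P r l (tailChain G l c) := by
  suffices h : tailChain G (l + 1) ∘ₗ prism P r (l + 1) =
      P.card • LinearMap.id - prism P r l ∘ₗ tailChain G l from LinearMap.congr_fun h c
  refine hom_ext_consChain fun x c => ?_
  simp [prism_consChain, tailChain_consChain, tailChain_sumConsChain]

end Prism

/-! ### The prism as a homotopy from `|P|` to `|P| r` -/

section PartialHomotopy

variable {G : Type} [CommGroup G] (P : Finset G)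

theorem mulHeadChain_sumConsChain (y : G) (l : ℕ) (c : IntChains G l) :
    mulHeadChain y l (sumConsChain P l c) = ∑ x ∈ P, consChain (y * x) l c := by
  simp [sumConsChain_apply, mulHeadChain_consChain]

theorem barDiff_sumConsChain (l : ℕ) (c : IntChains G (l + 1)) :
    barDiff G (l + 1) (sumConsChain P (l + 1) c) =
      P.card • c - ∑ x ∈ P, mulHeadChain x l c -
        sumConsChain P l (barDiff G l c - tailChain G l c) := by
  simp [sumConsChain_apply, barDiff_consChain, Finset.sum_sub_distrib]

variable (r : G →* G)

/-- The part of the prism starting with `r y` contributes nothing, since `r x * r y = r (x * y)`. -/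
theorem mulHeadChain_prism_sub (x : G) (l : ℕ) (c : IntChains G (l + 1)) :
    mulHeadChain (r x) (l + 1) (prism P r (l + 1) c) - prism P r (l + 1) (mulHeadChain x l c) =
      mulHeadChain (r x) (l + 1) (sumConsChain P (l + 1) c) -
        sumConsChain P (l + 1) (mulHeadChain x l c) := by
  suffices h : mulHeadChain (r x) (l + 1) ∘ₗ prism P r (l + 1) -
      prism P r (l + 1) ∘ₗ mulHeadChain x l =
      mulHeadChain (r x) (l + 1) ∘ₗ sumConsChain P (l + 1) -
        sumConsChain P (l + 1) ∘ₗ mulHeadChain x l from LinearMap.congr_fun h c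
  refine hom_ext_consChain fun y c => ?_
  simp [prism_consChain, mulHeadChain_consChain]

variable {P r}

/-- The cosets `P g` and `r(g) P` coincide, because `g * (r g)⁻¹` lies in `P`. -/
theorem sum_mulHeadChain_consChain (hP : ∀ p ∈ P, Set.BijOn (p * ·) P P)
    (hr : ∀ g, g * (r g)⁻¹ ∈ P) (g : G) (l : ℕ) (c : IntChains G l) :
    ∑ x ∈ P, mulHeadChain x l (consChain g l c) =
      mulHeadChain (r g) l (sumConsChain P l c) := by
  have h := hP _ (hr g)
  rw [mulHeadChain_sumConsChain]
  refine Finset.sum_nbij (g * (r g)⁻¹ * ·) h.mapsTo h.injOn h.surjOn fun x _ => ?_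
  rw [mulHeadChain_consChain]
  congr 2
  rw [mul_comm x, mul_assoc, mul_left_comm, mul_inv_cancel_left]

/-- Expand on `[g|c]`. The coset identity cancels the terms that merge `P` with `g`; the rest is the
inductive identity for `c` prefixed by `r g`, plus the commutator `mulHeadChain_prism_sub`. -/
theorem barDiff_prism_add (hP : ∀ p ∈ P, Set.BijOn (p * ·) P P)
    (hr : ∀ g, g * (r g)⁻¹ ∈ P) (l : ℕ) (c : IntChains G (l + 1)) :
    barDiff G (l + 1) (prism P r (l + 1) c) + prism P r l (barDiff G l c) =
      P.card • (c - pushChain r (l + 1) c) := by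
  induction l with
  | zero =>
    suffices h : barDiff G 1 ∘ₗ prism P r 1 + prism P r 0 ∘ₗ barDiff G 0 =
        P.card • (LinearMap.id - pushChain r 1) from LinearMap.congr_fun h c
    refine hom_ext_consChain fun g c => ?_
    have hpush : pushChain r 0 c = c := by
      have : (fun (g : Fin 0 → G) j => r (g j)) = id := funext fun g => Subsingleton.elim _ _
      rw [pushChain, Finsupp.lmapDomain_apply, this, Finsupp.mapDomain_id]
    simp only [LinearMap.add_apply, LinearMap.comp_apply, LinearMap.smul_apply,
      LinearMap.sub_apply, LinearMap.id_apply, prism_consChain, prism_zero, map_sub, map_zero,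
      barDiff_sumConsChain, barDiff_consChain, barDiff_zero, tailChain_consChain, smul_sub,
      tailChain_sumConsChain, pushChain_consChain, sum_mulHeadChain_consChain hP hr, hpush,
      map_nsmul]
    abel
  | succ l ih =>
    suffices h : barDiff G (l + 2) ∘ₗ prism P r (l + 2) + prism P r (l + 1) ∘ₗ barDiff G (l + 1) =
        P.card • (LinearMap.id - pushChain r (l + 2)) from LinearMap.congr_fun h c
    refine hom_ext_consChain fun g c => ?_
    have ih' := congrArg (consChain (r g) (l + 1)) (ih c)
    have hmul := mulHeadChain_prism_sub P r g l c
    simp only [map_add, map_sub, map_nsmul, smul_sub] at ih'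
    simp only [LinearMap.add_apply, LinearMap.comp_apply, LinearMap.smul_apply,
      LinearMap.sub_apply, LinearMap.id_apply, prism_consChain, map_sub, smul_sub,
      barDiff_sumConsChain, barDiff_consChain, tailChain_consChain,
      tailChain_prism, pushChain_consChain, sum_mulHeadChain_consChain hP hr, map_nsmul]
    linear_combination (norm := module) ih' + hmul

end PartialHomotopy

/-! ### Application to negation on `ℤ/n` -/

section BarChains

variable {G : Type} [Group G]

theorem barChains_d_apply (l : ℕ) (c : IntChains G (l + 1)) :
    ((barChains ℤ G ℤ).d (l + 1) l).hom c = barDiff G l c :=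
  congrArg (fun f => f.hom c) (groupHomology.inhomogeneousChains.d_def (Rep.trivial ℤ G ℤ) l)

theorem chainAction_eq_pushChain {Q : Type} [Group Q] (φ : Q →* MulAut G) (q : Q) (l : ℕ)
    (c : IntChains G l) :
    ((chainAction φ ℤ ℤ q).f l).hom c = pushChain (φ q) l c :=
  chainAction_apply φ ℤ ℤ q l c

/-- The endomorphism of the integral bar complex induced by an endomorphism of the group. -/
def barMap (r : G →* G) : barChains ℤ G ℤ ⟶ barChains ℤ G ℤ :=
  groupHomology.chainsMap (A := Rep.trivial ℤ G ℤ) (B := Rep.trivial ℤ G ℤ) r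
    (𝟙 (Rep.trivial ℤ G ℤ))

theorem barMap_apply (r : G →* G) (l : ℕ) (c : IntChains G l) :
    ((barMap r).f l).hom c = pushChain r l c := by
  let F : IntChains G l →ₗ[ℤ] IntChains G l := ((barMap r).f l).hom
  have h : F = pushChain r l :=
    Finsupp.lhom_ext fun g a => (groupHomology.chainsMap_f_single (A := Rep.trivial ℤ G ℤ)
      (B := Rep.trivial ℤ G ℤ) r (𝟙 (Rep.trivial ℤ G ℤ)) l g a).trans
      (Finsupp.mapDomain_single (f := fun (g : Fin l → G) j => r (g j))).symm
  exact LinearMap.congr_fun h c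

theorem pushChain_pushChain {G H K : Type} (f : H → K) (g : G → H) (l : ℕ) (c : IntChains G l) :
    pushChain f l (pushChain g l c) = pushChain (f ∘ g) l c := by
  simp only [pushChain, Finsupp.lmapDomain_apply, ← Finsupp.mapDomain_comp]
  rfl

end BarChains

theorem naturalMap_bijective_of_retraction {Q G : Type} [Group Q] [Fintype Q] [CommGroup G]
    (φ : Q →* MulAut G) {P : Finset G} {r : G →* G} (hP : ∀ p ∈ P, Set.BijOn (p * ·) P P)
    (hr : ∀ g, g * (r g)⁻¹ ∈ P) (hφP : ∀ q, Set.BijOn (φ q) P P)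
    (hφr : ∀ q g, φ q (r g) = r g) (hrφ : ∀ q g, r (φ q g) = r g)
    (hcard : P.card.Coprime (Fintype.card Q)) (l : ℕ) :
    Function.Bijective (naturalMap φ ℤ ℤ l) := by
  refine naturalMap_bijective_of_homotopy φ ℤ ℤ hcard (barMap r) (fun l c q => ?_)
    (fun l c => prism P r l c) (fun l q c => ?_) (fun l c hc => ?_) l
  · rw [barMap_apply]
    refine (chainAction_eq_pushChain φ q l _).trans ((pushChain_pushChain _ _ _ _).trans ?_)
    congr 2
    exact funext (hφr q)
  · refine (chainAction_eq_pushChain φ q (l + 1) _).trans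
      ((pushChain_prism P r (hφP q) (fun g => by rw [hφr, hrφ]) l c).trans ?_)
    exact congrArg (prism P r l) (chainAction_eq_pushChain φ q l c).symm
  · refine (barChains_d_apply l _).trans (Eq.trans ?_
      (congrArg (fun x : IntChains G l => P.card • ((c : IntChains G l) - x))
        (barMap_apply r l c).symm))
    cases l with
    -- In degree 0 both sides vanish: `d` is zero and `r` fixes the empty tuple.
    | zero =>
      have hid : (fun (g : Fin 0 → G) j => r (g j)) = id := funext fun g => Subsingleton.elim _ _
      rw [barDiff_zero, pushChain, Finsupp.lmapDomain_apply, hid, Finsupp.mapDomain_id]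
      exact (smul_eq_zero_of_right _ (sub_self _)).symm
    | succ l =>
      have hc' : barDiff G l c = 0 :=
        (barChains_d_apply l c).symm.trans ((mem_cycleSubmodule_succ _).1 hc)
      have h := barDiff_prism_add hP hr l c
      rwa [hc', map_zero, add_zero] at h

theorem negation_apply (n : ℕ) (q : Multiplicative (ZMod 2)) (x : Multiplicative (ZMod n)) :
    negation n q x = if q = 1 then x else x⁻¹ := by
  change (if q = 1 then 1 else MulEquiv.inv (Multiplicative (ZMod n)) : MulAut _) x = _
  split_ifs <;> rfl

/-- By Cauchy, an even order would give an element of order 2 killed by the odd exponent `m`. -/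
theorem odd_card_filter_pow_eq_one {G : Type} [CommGroup G] [Fintype G] [DecidableEq G] {m : ℕ}
    (hm : Odd m) : Odd (Finset.univ.filter fun x : G => x ^ m = 1).card := by
  rw [← Nat.not_even_iff_odd, even_iff_two_dvd]
  intro h
  have hcard : Nat.card (powMonoidHom (α := G) m).ker =
      (Finset.univ.filter fun x : G => x ^ m = 1).card := by
    rw [Nat.card_eq_fintype_card, Fintype.card_subtype]
    simp [MonoidHom.mem_ker]
  have : Fact (Nat.Prime 2) := ⟨Nat.prime_two⟩
  obtain ⟨x, hx⟩ := exists_prime_orderOf_dvd_card' (G := (powMonoidHom (α := G) m).ker) 2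
    (hcard ▸ h)
  have hxm : x ^ m = 1 := Subtype.ext x.2
  have := orderOf_dvd_of_pow_eq_one hxm
  rw [hx] at this
  exact Nat.not_even_iff_odd.2 hm (even_iff_two_dvd.2 this)

theorem naturalMap_negation_bijective {n : ℕ} (hn : ¬ n ≡ 0 [MOD 4]) (l : ℕ) :
    Function.Bijective (naturalMap (negation n) ℤ ℤ l) := by
  have hn4 : n % 4 ≠ 0 := hn
  -- The only use of `4 ∤ n` beyond `n ≠ 0`: `n / 2` is odd when `n` is even.
  obtain ⟨m, hm, hnm⟩ : ∃ m, Odd m ∧ n ∣ 2 * m := by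
    rcases Nat.even_or_odd n with h | h
    · exact ⟨n / 2, by rw [Nat.odd_iff]; rw [Nat.even_iff] at h; omega,
        by rw [Nat.mul_div_cancel' (even_iff_two_dvd.1 h)]⟩
    · exact ⟨n, h, dvd_mul_left _ _⟩
  have : NeZero n := ⟨by rintro rfl; exact hn4 rfl⟩
  have hpow (x : Multiplicative (ZMod n)) {a : ℕ} (ha : n ∣ a) : x ^ a = 1 := by
    refine orderOf_dvd_iff_pow_eq_one.1 ((orderOf_dvd_card (x := x)).trans ?_)
    rwa [Fintype.card_multiplicative, ZMod.card]
  have hinv (x : Multiplicative (ZMod n)) : (x ^ m)⁻¹ = x ^ m := by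
    rw [inv_eq_iff_mul_eq_one, ← pow_add, ← two_mul]
    exact hpow x hnm
  refine naturalMap_bijective_of_retraction (negation n)
    (P := Finset.univ.filter fun x => x ^ m = 1) (r := powMonoidHom m) (fun p hp => ?_)
    (fun g => ?_) (fun q => ?_) (fun q g => ?_) (fun q g => ?_) ?_ l
  · rw [Finset.mem_filter] at hp
    refine ⟨fun x hx => ?_, (mul_right_injective p).injOn, fun x hx => ⟨p⁻¹ * x, ?_, ?_⟩⟩
    · simp_all [mul_pow]
    · simp_all [mul_pow]
    · simp
  · rw [Finset.mem_filter]
    refine ⟨Finset.mem_univ _, ?_⟩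
    -- As `g ^ m` is its own inverse, the element is `g ^ (m + 1)`; its `m`-th power is trivial
    -- because `m + 1` is even and `n ∣ 2m`.
    obtain ⟨j, hj⟩ := hm
    rw [powMonoidHom_apply, hinv, ← pow_succ', ← pow_mul]
    exact hpow g (hnm.trans ⟨j + 1, by rw [hj]; ring⟩)
  · by_cases hq : q = 1
    · subst hq
      rw [map_one]
      exact Set.bijOn_id _
    · refine ⟨fun x hx => ?_, (negation n q).injective.injOn, fun x hx => ⟨x⁻¹, ?_, ?_⟩⟩
      · simp_all [negation_apply]
      · simp_all
      · simp [negation_apply, hq]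
  · rw [negation_apply]
    split_ifs
    · rfl
    · exact hinv g
  · rw [negation_apply]
    split_ifs
    · rfl
    · rw [powMonoidHom_apply, inv_pow, hinv, powMonoidHom_apply]
  · have h2 : Fintype.card (Multiplicative (ZMod 2)) = 2 := rfl
    rw [h2, Nat.coprime_two_right]
    exact odd_card_filter_pow_eq_one hm

/-! ### Cap products with 1- and 2-cochains -/

section Cap

variable {G : Type}

/-- Contraction of the first entry of a chain with a function. -/
def capOne (t : G → ℤ) (l : ℕ) : IntChains G (l + 1) →ₗ[ℤ] IntChains G l :=
  Finsupp.lsum ℤ fun g => t (g 0) • Finsupp.lsingle (Fin.tail g)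

/-- Contraction of the first two entries of a chain with a function of two variables. -/
def capTwo (f : G → G → ℤ) (l : ℕ) : IntChains G (l + 2) →ₗ[ℤ] IntChains G l :=
  Finsupp.lsum ℤ fun g => f (g 0) (g 1) • Finsupp.lsingle (Fin.tail (Fin.tail g))

theorem capOne_consChain (t : G → ℤ) (x : G) (l : ℕ) (c : IntChains G l) :
    capOne t l (consChain x l c) = t x • c := by
  induction c using Finsupp.induction_linear with
  | zero => simp
  | add f g hf hg => simp only [map_add, hf, hg, smul_add]
  | single g a => simp [capOne, consChain_single]

theorem capTwo_consChain (f : G → G → ℤ) (x y : G) (l : ℕ) (c : IntChains G l) :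
    capTwo f l (consChain x (l + 1) (consChain y l c)) = f x y • c := by
  induction c using Finsupp.induction_linear with
  | zero => simp
  | add f g hf hg => simp only [map_add, hf, hg, smul_add]
  | single g a =>
    have h : Fin.cons (α := fun _ => G) x (Fin.cons (α := fun _ => G) y g) 1 = y := rfl
    simp [capTwo, consChain_single, h]

theorem hom_ext_consChain_consChain {M : Type} [AddCommGroup M] {l : ℕ}
    {f f' : IntChains G (l + 2) →ₗ[ℤ] M}
    (h : ∀ x y c, f (consChain x (l + 1) (consChain y l c)) =
      f' (consChain x (l + 1) (consChain y l c))) : f = f' :=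
  hom_ext_consChain fun x c => by
    have : f ∘ₗ consChain x (l + 1) = f' ∘ₗ consChain x (l + 1) :=
      hom_ext_consChain fun y c => h x y c
    exact LinearMap.congr_fun this c

theorem capTwo_pushChain (f : G → G → ℤ) (σ : G → G) (l : ℕ) (c : IntChains G (l + 2)) :
    capTwo f l (pushChain σ (l + 2) c) =
      pushChain σ l (capTwo (fun x y => f (σ x) (σ y)) l c) := by
  suffices h : capTwo f l ∘ₗ pushChain σ (l + 2) =
      pushChain σ l ∘ₗ capTwo (fun x y => f (σ x) (σ y)) l from LinearMap.congr_fun h c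
  refine hom_ext_consChain_consChain fun x y c => ?_
  simp only [LinearMap.comp_apply, pushChain_consChain, capTwo_consChain, map_smul]

theorem capTwo_sub_apply (f f' : G → G → ℤ) (l : ℕ) (c : IntChains G (l + 2)) :
    capTwo (fun x y => f' x y - f x y) l c = capTwo f' l c - capTwo f l c := by
  suffices h : capTwo (fun x y => f' x y - f x y) l = capTwo f' l - capTwo f l from
    LinearMap.congr_fun h c
  refine hom_ext_consChain_consChain fun x y c => ?_
  simp only [LinearMap.sub_apply, capTwo_consChain, sub_smul]

variable [Group G]

/-- The hypothesis is the 2-cocycle identity, and capping with a cocycle of even degree is a chain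
map. -/
theorem barDiff_capTwo {f : G → G → ℤ}
    (hf : ∀ x y z, f y z + f x (y * z) = f (x * y) z + f x y) (l : ℕ) (c : IntChains G (l + 3)) :
    barDiff G l (capTwo f (l + 1) c) = capTwo f l (barDiff G (l + 2) c) := by
  suffices h : barDiff G l ∘ₗ capTwo f (l + 1) = capTwo f l ∘ₗ barDiff G (l + 2) from
    LinearMap.congr_fun h c
  refine hom_ext_consChain_consChain fun x y c => ?_
  simp only [LinearMap.comp_apply, capTwo_consChain, barDiff_consChain, map_smul, map_sub,
    mulHeadChain_consChain, tailChain_consChain]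
  suffices h : f x y • barDiff G l c =
      capTwo f l (consChain y (l + 1) c) - capTwo f l (consChain (x * y) (l + 1) c)
        + capTwo f l (consChain x (l + 1) (mulHeadChain y l c))
        + f x y • (barDiff G l c - tailChain G l c) by
    refine Eq.trans h ?_
    module
  -- The terms in `barDiff G l c` cancel; on `[z|c]` the rest is the cocycle identity at `x, y, z`.
  suffices h : f x y • tailChain G l =
      capTwo f l ∘ₗ consChain y (l + 1) - capTwo f l ∘ₗ consChain (x * y) (l + 1)
        + capTwo f l ∘ₗ consChain x (l + 1) ∘ₗ mulHeadChain y l by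
    have := LinearMap.congr_fun h c
    simp only [LinearMap.add_apply, LinearMap.sub_apply, LinearMap.comp_apply,
      LinearMap.smul_apply] at this
    rw [← this]
    module
  refine hom_ext_consChain fun z c => ?_
  simp only [LinearMap.add_apply, LinearMap.sub_apply, LinearMap.comp_apply, capTwo_consChain,
    LinearMap.smul_apply, tailChain_consChain, mulHeadChain_consChain]
  rw [← sub_smul, ← add_smul]
  congr 1
  linarith [hf x y z]

/-- Capping with `t` is a null-homotopy of capping with its coboundary, so cohomologous cocycles act
alike on homology. -/
theorem capTwo_coboundary (t : G → ℤ) (l : ℕ) (c : IntChains G (l + 2)) :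
    capTwo (fun x y => t x + t y - t (x * y)) l c =
      barDiff G l (capOne t (l + 1) c) + capOne t l (barDiff G (l + 1) c) := by
  suffices h : capTwo (fun x y => t x + t y - t (x * y)) l =
      barDiff G l ∘ₗ capOne t (l + 1) + capOne t l ∘ₗ barDiff G (l + 1) from
    LinearMap.congr_fun h c
  refine hom_ext_consChain_consChain fun x y c => ?_
  simp only [LinearMap.add_apply, LinearMap.comp_apply, capTwo_consChain, barDiff_consChain,
    map_smul, map_sub, mulHeadChain_consChain, tailChain_consChain, capOne_consChain]
  module

theorem barDiff_pushChain (r : G →* G) (l : ℕ) (c : IntChains G (l + 1)) :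
    barDiff G l (pushChain r (l + 1) c) = pushChain r l (barDiff G l c) := by
  have h : ((barChains ℤ G ℤ).d (l + 1) l).hom (((barMap r).f (l + 1)).hom c) =
      ((barMap r).f l).hom (((barChains ℤ G ℤ).d (l + 1) l).hom c) :=
    congrArg (fun f => f.hom c) ((barMap r).comm (l + 1) l)
  rw [barMap_apply, barChains_d_apply] at h
  exact h.trans ((barMap_apply r l _).trans (congrArg (pushChain r l) (barChains_d_apply l c)))

end Cap

/-! ### Explicit cycles in odd degrees -/

section PeriodicCycle

variable {G : Type} [Fintype G]

/-- The cycle `∑ [g|x₁|g|x₂|⋯|g]`, the sum being over all `x₁, …, xᵢ`. -/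
def periodicCycle (g : G) : ∀ i : ℕ, IntChains G (2 * i + 1)
  | 0 => consChain g 0 (Finsupp.single Fin.elim0 1)
  | i + 1 => consChain g (2 * i + 2) (sumConsChain Finset.univ (2 * i + 1) (periodicCycle g i))

theorem periodicCycle_succ (g : G) (i : ℕ) : periodicCycle g (i + 1) =
    consChain g (2 * i + 2) (sumConsChain Finset.univ (2 * i + 1) (periodicCycle g i)) := rfl

theorem exists_periodicCycle_eq (g : G) (i : ℕ) :
    ∃ w, periodicCycle g i = consChain g (2 * i) w := by
  cases i with
  | zero => exact ⟨_, rfl⟩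
  | succ i => exact ⟨_, rfl⟩

variable [CommGroup G]

theorem mulHeadChain_sumConsChain_univ (y : G) (l : ℕ) (c : IntChains G l) :
    mulHeadChain y l (sumConsChain Finset.univ l c) = sumConsChain Finset.univ l c := by
  rw [mulHeadChain_sumConsChain, sumConsChain_apply]
  exact Fintype.sum_equiv (Equiv.mulLeft y) _ _ fun _ => rfl

/-- A sum over all of `G` is unchanged by translation: by `g` on the left for the outer entry, on
the right for the next `g`. -/
theorem barDiff_periodicCycle (g : G) (i : ℕ) : barDiff G (2 * i) (periodicCycle g i) = 0 := by
  induction i with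
  | zero => exact barDiff_zero _
  | succ i ih =>
    obtain ⟨w, hw⟩ := exists_periodicCycle_eq g i
    have hsum : ∑ x : G, mulHeadChain x (2 * i) (consChain g (2 * i) w) =
        sumConsChain Finset.univ (2 * i) w := by
      rw [sumConsChain_apply]
      exact Fintype.sum_equiv (Equiv.mulRight g) _ _ fun x => mulHeadChain_consChain _ _ _ _
    refine (barDiff_consChain g (2 * i + 1) _).trans ?_
    rw [mulHeadChain_sumConsChain_univ, barDiff_sumConsChain, ih, tailChain_sumConsChain, hw, hsum,
      tailChain_consChain]
    simp

end PeriodicCycle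

/-! ### Pairing odd homology with `f ^ i ∪ e` -/

section Pairing

variable {G : Type} [CommGroup G] {n : ℕ} (e : G →* Multiplicative (ZMod n)) (f : G → G → ℤ)

/-- The cochain `[x₁|y₁|⋯|xᵢ|yᵢ|g] ↦ f(x₁, y₁) ⋯ f(xᵢ, yᵢ) e(g)`. -/
def capPairing : ∀ i : ℕ, IntChains G (2 * i + 1) →ₗ[ℤ] ZMod n
  | 0 => Finsupp.lsum ℤ fun g => LinearMap.toSpanSingleton ℤ (ZMod n) (e (g 0)).toAdd
  | i + 1 => capPairing i ∘ₗ capTwo f (2 * i + 1)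

theorem capPairing_succ (i : ℕ) (c : IntChains G (2 * i + 3)) :
    capPairing e f (i + 1) c = capPairing e f i (capTwo f (2 * i + 1) c) := rfl

theorem capPairing_zero_consChain (x : G) (c : IntChains G 0) :
    capPairing e f 0 (consChain x 0 c) = c default • (e x).toAdd := by
  induction c using Finsupp.induction_linear with
  | zero => simp
  | add f g hf hg => simp only [map_add, hf, hg, Finsupp.add_apply, add_smul]
  | single g a =>
    rw [consChain_single, Subsingleton.elim g default]
    simp [capPairing]

variable {e f}

/-- Capping with the cocycle `f` reduces to `i = 0`, where `e` is a homomorphism. -/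
theorem capPairing_barDiff (hf : ∀ x y z, f y z + f x (y * z) = f (x * y) z + f x y) (i : ℕ)
    (c : IntChains G (2 * i + 2)) : capPairing e f i (barDiff G (2 * i + 1) c) = 0 := by
  induction i with
  | zero =>
    suffices h : capPairing e f 0 ∘ₗ barDiff G 1 = 0 from LinearMap.congr_fun h c
    refine hom_ext_consChain_consChain fun x y c => ?_
    simp only [LinearMap.comp_apply, barDiff_consChain, barDiff_zero, map_sub,
      mulHeadChain_consChain, tailChain_consChain, capPairing_zero_consChain, map_zero,
      LinearMap.zero_apply, map_mul, toAdd_mul]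
    module
  | succ i ih =>
    exact (congrArg (capPairing e f i) (barDiff_capTwo hf (2 * i + 1) c).symm).trans (ih _)

/-- Inversion sends `f` to `-f` modulo the coboundary of `t`, so each cap contributes a sign, and
`e` the last one. The chain must be a cycle for the coboundary to contribute only a boundary. -/
theorem capPairing_pushChain_inv (hf : ∀ x y z, f y z + f x (y * z) = f (x * y) z + f x y)
    {t : G → ℤ} (ht : ∀ x y, f x⁻¹ y⁻¹ + f x y = t x + t y - t (x * y)) (i : ℕ)
    (c : IntChains G (2 * i + 1)) (hc : barDiff G (2 * i) c = 0) :
    capPairing e f i (pushChain (fun x => x⁻¹) (2 * i + 1) c) =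
      (-1) ^ (i + 1) * capPairing e f i c := by
  induction i with
  | zero =>
    suffices h : capPairing e f 0 ∘ₗ pushChain (fun x => x⁻¹) 1 = - capPairing e f 0 by
      simpa using LinearMap.congr_fun h c
    refine hom_ext_consChain fun x c => ?_
    have hpush : pushChain (fun x : G => x⁻¹) 0 c = c := by
      have : (fun (g : Fin 0 → G) j => (g j)⁻¹) = id := funext fun g => Subsingleton.elim _ _
      rw [pushChain, Finsupp.lmapDomain_apply, this, Finsupp.mapDomain_id]
    simp only [LinearMap.comp_apply, LinearMap.neg_apply, pushChain_consChain, hpush,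
      capPairing_zero_consChain, map_inv, toAdd_inv, smul_neg]
  | succ i ih =>
    have hcap : capTwo (fun x y => f x⁻¹ y⁻¹) (2 * i + 1) c =
        barDiff G (2 * i + 1) (capOne t (2 * i + 2) c) - capTwo f (2 * i + 1) c := by
      have h := capTwo_coboundary t (2 * i + 1) c
      rw [show barDiff G (2 * i + 1 + 1) c = 0 from hc, map_zero, add_zero] at h
      rw [← h, ← capTwo_sub_apply]
      congr 2
      funext x y
      linarith [ht x y]
    have hcyc : barDiff G (2 * i) (capTwo f (2 * i + 1) c) = 0 := by
      rw [barDiff_capTwo hf, show barDiff G (2 * i + 2) c = 0 from hc, map_zero]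
    have hpush := capTwo_pushChain f (fun x : G => x⁻¹) (2 * i + 1) c
    refine (congrArg (capPairing e f i) hpush).trans ?_
    rw [hcap, map_sub, map_sub, ih _ hcyc]
    have hb := barDiff_pushChain (invMonoidHom (α := G)) (2 * i + 1) (capOne t (2 * i + 2) c)
    have hb' : capPairing e f i (pushChain (fun x : G => x⁻¹) (2 * i + 1)
        (barDiff G (2 * i + 1) (capOne t (2 * i + 2) c))) = 0 :=
      (congrArg (capPairing e f i) hb.symm).trans (capPairing_barDiff hf i _)
    rw [hb', capPairing_succ, pow_succ _ (i + 1)]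
    ring

theorem capPairing_periodicCycle [Fintype G] {g : G} (he : (e g).toAdd = 1)
    (hfg : ((∑ x, f g x : ℤ) : ZMod n) = 1) (i : ℕ) :
    capPairing e f i (periodicCycle g i) = 1 := by
  induction i with
  | zero =>
    refine (capPairing_zero_consChain e f _ _).trans ?_
    rw [he, Subsingleton.elim Fin.elim0 (default : Fin 0 → G)]
    simp
  | succ i ih =>
    rw [capPairing_succ, periodicCycle_succ, sumConsChain_apply]
    simp only [map_sum]
    refine (Finset.sum_congr rfl fun x _ => congrArg (capPairing e f i)
      (capTwo_consChain f g x (2 * i + 1) (periodicCycle g i))).trans ?_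
    simp only [map_smul, ih]
    rw [← Finset.sum_smul, zsmul_one, hfg]

end Pairing

/-! ### The carry cocycle of `ℤ/n` -/

section Carry

variable {n : ℕ} [NeZero n]

/-- The carry in the addition of two residues. -/
def carry (x y : ZMod n) : ℤ := ((x.val + y.val) / n : ℕ)

theorem mul_carry (x y : ZMod n) : n * carry x y = x.val + y.val - (x + y).val := by
  have h := Nat.div_add_mod (x.val + y.val) n
  rw [← ZMod.val_add] at h
  rw [carry, eq_sub_iff_add_eq]
  exact_mod_cast h

theorem carry_add (x y z : ZMod n) :
    carry y z + carry x (y + z) = carry (x + y) z + carry x y := by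
  have hn : (n : ℤ) ≠ 0 := Nat.cast_ne_zero.2 (NeZero.ne n)
  apply mul_left_cancel₀ hn
  simp only [mul_add, mul_carry, add_assoc]
  ring

/-- After multiplication by `n`, the carry is the coboundary of `val`, and `n * carry x (-x) = x.val
+ (-x).val`. -/
theorem carry_neg_add_carry (x y : ZMod n) : carry (-x) (-y) + carry x y =
    carry x (-x) + carry y (-y) - carry (x + y) (-(x + y)) := by
  have hn : (n : ℤ) ≠ 0 := Nat.cast_ne_zero.2 (NeZero.ne n)
  apply mul_left_cancel₀ hn
  simp only [mul_add, mul_sub, mul_carry, add_neg_cancel, ZMod.val_zero, ← neg_add]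
  push_cast
  ring

theorem sum_carry (x : ZMod n) : ∑ y, carry x y = x.val := by
  have hn : (n : ℤ) ≠ 0 := Nat.cast_ne_zero.2 (NeZero.ne n)
  apply mul_left_cancel₀ hn
  rw [Finset.mul_sum]
  simp only [mul_carry]
  rw [Finset.sum_sub_distrib, Finset.sum_add_distrib,
    Fintype.sum_equiv (Equiv.addLeft x) (fun y => ((x + y).val : ℤ)) (fun y => (y.val : ℤ))
      fun _ => rfl]
  simp

end Carry

/-! ### Homology of finite cyclic groups -/

section CyclicHomology

theorem nonempty_addEquiv_zmod {M : Type} [AddCommGroup M] {n : ℕ} (π : ℤ →+ M)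
    (hπ : Function.Surjective π) (hker : ∀ x, π x = 0 ↔ (n : ℤ) ∣ x) : Nonempty (M ≃+ ZMod n) := by
  have h : π.ker = AddSubgroup.zmultiples (n : ℤ) := by
    ext x
    rw [AddMonoidHom.mem_ker, hker, Int.mem_zmultiples_iff]
  exact ⟨(QuotientAddGroup.quotientKerEquivOfSurjective π hπ).symm.trans
    ((QuotientAddGroup.quotientAddEquivOfEq h).trans (Int.quotientZMultiplesNatEquivZMod n))⟩

variable {G : Type} [CommGroup G] [Fintype G]

theorem norm_trivial_apply (x : ℤ) :
    (Rep.trivial ℤ G ℤ).ρ.norm x = (Fintype.card G : ℤ) * x := by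
  simp [Representation.norm]

variable [DecidableEq G] {g : G}

theorem groupHomologyπEven_surjective (A : Rep ℤ G) (hg : ∀ x, x ∈ Subgroup.zpowers g) {l : ℕ}
    [NeZero l] (he : Even l) :
    Function.Surjective (Rep.FiniteCyclicGroup.groupHomologyπEven A g hg l he) :=
  (ModuleCat.epi_iff_surjective _).1 <|
    epi_comp' (inferInstanceAs (Epi (ShortComplex.moduleCatCyclesIso _).inv))
      (epi_comp' inferInstance (inferInstanceAs (Epi (Iso.inv _))))

theorem groupHomologyπOdd_surjective (A : Rep ℤ G) (hg : ∀ x, x ∈ Subgroup.zpowers g) {l : ℕ}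
    (ho : Odd l) :
    Function.Surjective (Rep.FiniteCyclicGroup.groupHomologyπOdd A g hg l ho) :=
  (ModuleCat.epi_iff_surjective _).1 <|
    epi_comp' (inferInstanceAs (Epi (ShortComplex.moduleCatCyclesIso _).inv))
      (epi_comp' inferInstance (inferInstanceAs (Epi (Iso.inv _))))

/-- Cycles of the periodic complex form the kernel of the norm, here multiplication by `|G|`,
injective on `ℤ`. -/
theorem subsingleton_barHomology_even (hg : ∀ x, x ∈ Subgroup.zpowers g) {l : ℕ} (hl : 0 < l)
    (he : Even l) : Subsingleton (barHomology ℤ G ℤ l) := by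
  have : NeZero l := ⟨hl.ne'⟩
  refine subsingleton_of_forall_eq 0 fun y => ?_
  obtain ⟨x, rfl⟩ : ∃ x, (Rep.FiniteCyclicGroup.groupHomologyπEven (Rep.trivial ℤ G ℤ) g hg l he)
      x = y := groupHomologyπEven_surjective _ hg he y
  rw [Rep.FiniteCyclicGroup.groupHomologyπEven_eq_zero_iff]
  have hx : (Rep.trivial ℤ G ℤ).ρ.norm x.1 = 0 := x.2
  rw [norm_trivial_apply] at hx
  have hx0 : x.1 = (0 : ℤ) := (mul_eq_zero.1 hx).resolve_left (by simp)
  rw [hx0]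
  exact zero_mem _

/-- The generator acts trivially, so all of `ℤ` consists of cycles, modulo the image `|G| ℤ` of the
norm. -/
theorem barHomology_odd_addEquiv (hg : ∀ x, x ∈ Subgroup.zpowers g) {l : ℕ} (ho : Odd l) :
    Nonempty (barHomology ℤ G ℤ l ≃+ ZMod (Fintype.card G)) := by
  let V := LinearMap.ker (Rep.applyAsHom (Rep.trivial ℤ G ℤ) g -
    𝟙 (Rep.trivial ℤ G ℤ)).hom.toLinearMap
  have htop (x : ℤ) : x ∈ V := by
    change (Rep.applyAsHom (Rep.trivial ℤ G ℤ) g - 𝟙 (Rep.trivial ℤ G ℤ)).hom.toLinearMap x = 0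
    simp [Rep.sub_hom, Rep.applyAsHom]
  let ι : ℤ →+ V := ⟨⟨fun x => ⟨x, htop x⟩, rfl⟩, fun _ _ => rfl⟩
  let p := Rep.FiniteCyclicGroup.groupHomologyπOdd (Rep.trivial ℤ G ℤ) g hg l ho
  refine nonempty_addEquiv_zmod (p.hom.toAddMonoidHom.comp ι) (fun y => ?_) fun x => ?_
  · obtain ⟨x, rfl⟩ : ∃ x, p x = y := groupHomologyπOdd_surjective _ hg ho y
    exact ⟨x.1, rfl⟩
  · refine (Rep.FiniteCyclicGroup.groupHomologyπOdd_eq_zero_iff _ _ hg l ho (ι x)).trans ?_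
    refine exists_congr fun y => ?_
    rw [norm_trivial_apply, eq_comm]
    rfl

end CyclicHomology

theorem mem_cycleSubmodule_iff_barDiff {G : Type} [Group G] {l : ℕ} {c : IntChains G (l + 1)} :
    c ∈ cycleSubmodule (barChains ℤ G ℤ) (l + 1) ↔ barDiff G l c = 0 :=
  (mem_cycleSubmodule_succ (barChains ℤ G ℤ) (z := c)).trans
    (by rw [← barChains_d_apply])

section Action

variable {Q G : Type} [Group Q] [Group G] (φ : Q →* MulAut G)

theorem homologyAction_one_apply (l : ℕ) (x : barHomology ℤ G ℤ l) :
    (homologyAction φ ℤ ℤ 1 l).hom x = x := by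
  obtain ⟨z, rfl⟩ := homologyClass_surjective _ _ x
  refine (homologyAction_homologyClass φ ℤ ℤ 1 z).trans ?_
  congr 1
  refine Subtype.ext ((chainAction_eq_pushChain φ 1 l z.1).trans ?_)
  rw [pushChain, map_one]
  exact Finsupp.mapDomain_id

theorem homologyAction_zero_apply (q : Q) (x : barHomology ℤ G ℤ 0) :
    (homologyAction φ ℤ ℤ q 0).hom x = x := by
  obtain ⟨z, rfl⟩ := homologyClass_surjective _ _ x
  refine (homologyAction_homologyClass φ ℤ ℤ q z).trans ?_
  congr 1
  refine Subtype.ext ((chainAction_eq_pushChain φ q 0 z.1).trans ?_)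
  have hid : (fun (g : Fin 0 → G) j => φ q (g j)) = id := funext fun g => Subsingleton.elim _ _
  rw [pushChain, hid]
  exact Finsupp.mapDomain_id

variable (G) in
theorem barHomology_zero_addEquiv : Nonempty (barHomology ℤ G ℤ 0 ≃+ ℤ) := by
  let ι : IntChains G 0 →+ cycleSubmodule (barChains ℤ G ℤ) 0 :=
    ⟨⟨fun c => ⟨c, mem_cycleSubmodule_zero _ c⟩, rfl⟩, fun _ _ => rfl⟩
  let f : IntChains G 0 →+ barHomology ℤ G ℤ 0 := (homologyClass _ 0).toAddMonoidHom.comp ι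
  have hf : Function.Bijective f := by
    refine ⟨(injective_iff_map_eq_zero f).2 fun c hc => ?_, fun y => ?_⟩
    · obtain ⟨w, hw⟩ := (homologyClass_eq_zero_iff (barChains ℤ G ℤ) (ι c)).1 hc
      exact hw.symm.trans ((barChains_d_apply 0 w).trans (barDiff_zero w))
    · obtain ⟨z, rfl⟩ := homologyClass_surjective _ _ y
      exact ⟨z.1, rfl⟩
  exact ⟨(AddEquiv.ofBijective f hf).symm.trans
    (Finsupp.uniqueAddEquiv (ι := Fin 0 → G) default)⟩

end Action

/-! ### Negation on the homology of `ℤ/n` -/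

section Cyclic

/-- A submodule equal to the whole module, as an additive group. -/
def addEquivOfEqTop {R M : Type} [CommRing R] [AddCommGroup M] [Module R M] {N : Submodule R M}
    (h : N = ⊤) : N ≃+ M :=
  (LinearEquiv.ofTop N h).toAddEquiv

variable (n : ℕ)

theorem mem_homologyInvariants_negation {l : ℕ}
    {x : barHomology ℤ (Multiplicative (ZMod n)) ℤ l} :
    x ∈ homologyInvariants (negation n) ℤ ℤ l ↔
      (homologyAction (negation n) ℤ ℤ (Multiplicative.ofAdd 1) l).hom x = x := by
  refine ⟨fun h => h _, fun h q => ?_⟩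
  have hq : ∀ q : Multiplicative (ZMod 2), q = 1 ∨ q = Multiplicative.ofAdd 1 := by decide
  obtain rfl | rfl := hq q
  · exact homologyAction_one_apply _ _ _
  · exact h

theorem mem_zpowers_ofAdd_one (x : Multiplicative (ZMod n)) :
    x ∈ Subgroup.zpowers (Multiplicative.ofAdd (1 : ZMod n)) := by
  obtain ⟨a, ha⟩ := ZMod.intCast_surjective x.toAdd
  refine ⟨a, ?_⟩
  change Multiplicative.ofAdd (1 : ZMod n) ^ a = x
  rw [← ofAdd_zsmul, zsmul_one, ha, ofAdd_toAdd]

variable {n} in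
theorem mem_homologyInvariants_negation_of_even {i : ℕ} (hi : Even i)
    {e : barHomology ℤ (Multiplicative (ZMod n)) ℤ (2 * i + 1) ≃+ ZMod n}
    (he : ∀ x, e ((homologyAction (negation n) ℤ ℤ (Multiplicative.ofAdd 1) (2 * i + 1)).hom x) =
        (-1) ^ (i + 1) * e x) (x) :
    x ∈ homologyInvariants (negation n) ℤ ℤ (2 * i + 1) ↔ 2 * e x = 0 := by
  rw [mem_homologyInvariants_negation, ← e.injective.eq_iff, he, hi.add_one.neg_one_pow,
    neg_one_mul, neg_eq_iff_add_eq_zero, two_mul (e x)]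

variable [NeZero n]

/-- The homology of `ℤ/n` in degree `2i + 1` is `ℤ/n`, and negation acts by `(-1)^(i + 1)`. -/
theorem exists_barHomology_odd_equiv (i : ℕ) :
    ∃ e : barHomology ℤ (Multiplicative (ZMod n)) ℤ (2 * i + 1) ≃+ ZMod n,
      ∀ x, e ((homologyAction (negation n) ℤ ℤ (Multiplicative.ofAdd 1) (2 * i + 1)).hom x) =
        (-1) ^ (i + 1) * e x := by
  let G := Multiplicative (ZMod n)
  let g : G := Multiplicative.ofAdd 1
  let f : G → G → ℤ := fun x y => carry x.toAdd y.toAdd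
  have hf (x y z : G) : f y z + f x (y * z) = f (x * y) z + f x y := carry_add _ _ _
  have ht (x y : G) : f x⁻¹ y⁻¹ + f x y = f x x⁻¹ + f y y⁻¹ - f (x * y) (x * y)⁻¹ :=
    carry_neg_add_carry _ _
  let θ := capPairing (MonoidHom.id G) f i
  let cls := homologyClass (barChains ℤ G ℤ) (2 * i + 1)
  have hcls : Function.Surjective cls := homologyClass_surjective _ _
  let θ' : cycleSubmodule (barChains ℤ G ℤ) (2 * i + 1) →+ ZMod n :=
    θ.toAddMonoidHom.comp (cycleSubmodule (barChains ℤ G ℤ) (2 * i + 1)).subtype.toAddMonoidHom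
  have hker : cls.toAddMonoidHom.ker ≤ θ'.ker := by
    intro z hz
    obtain ⟨w, hw⟩ := (homologyClass_eq_zero_iff _ z).1 hz
    refine (congrArg θ (hw.symm.trans (barChains_d_apply _ w))).trans ?_
    exact capPairing_barDiff hf i w
  let Θ : barHomology ℤ G ℤ (2 * i + 1) →+ ZMod n :=
    cls.toAddMonoidHom.liftOfRightInverse _ (Function.rightInverse_surjInv hcls) ⟨θ', hker⟩
  have hΘ (z) : Θ (cls z) = θ z.1 :=
    AddMonoidHom.liftOfRightInverse_comp_apply cls.toAddMonoidHom _
      (Function.rightInverse_surjInv hcls) ⟨θ', hker⟩ z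
  have hsurj : Function.Surjective Θ := by
    intro a
    have hsum : ((∑ x : G, f g x : ℤ) : ZMod n) = 1 := by
      have h := congrArg (Int.cast : ℤ → ZMod n) (sum_carry (1 : ZMod n))
      rw [Int.cast_natCast, ZMod.natCast_zmod_val] at h
      rw [← h, Fintype.sum_equiv Multiplicative.toAdd (f g) (carry (1 : ZMod n)) fun _ => rfl]
    have h1 : Θ (cls ⟨periodicCycle g i, mem_cycleSubmodule_iff_barDiff.2
        (barDiff_periodicCycle g i)⟩) = 1 :=
      (hΘ _).trans (capPairing_periodicCycle rfl hsum i)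
    obtain ⟨b, rfl⟩ := ZMod.intCast_surjective a
    exact ⟨b • _, (map_zsmul Θ b _).trans ((congrArg (b • ·) h1).trans (zsmul_one b))⟩
  -- `E` supplies only the order `n`, which makes the surjection `Θ` bijective; the action is read
  -- off from `Θ`.
  obtain ⟨E⟩ := barHomology_odd_addEquiv (mem_zpowers_ofAdd_one n) (odd_two_mul_add_one i)
  rw [Fintype.card_multiplicative, ZMod.card] at E
  have hbij : Function.Bijective Θ := by
    have : Finite (barHomology ℤ G ℤ (2 * i + 1)) := Finite.of_equiv _ E.symm.toEquiv
    exact (Nat.bijective_iff_surjective_and_card Θ).2 ⟨hsurj, Nat.card_congr E.toEquiv⟩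
  refine ⟨AddEquiv.ofBijective Θ hbij, fun x => ?_⟩
  obtain ⟨z, rfl⟩ := hcls x
  have hz : barDiff G (2 * i) z.1 = 0 := mem_cycleSubmodule_iff_barDiff.1 z.2
  calc Θ ((homologyAction (negation n) ℤ ℤ (Multiplicative.ofAdd 1) (2 * i + 1)).hom (cls z))
      = θ (pushChain (fun x : G => x⁻¹) (2 * i + 1) z.1) := by
        refine (congrArg Θ (homologyAction_homologyClass (negation n) ℤ ℤ _ z)).trans
          ((hΘ _).trans (congrArg θ ?_))
        exact chainAction_eq_pushChain (negation n) (Multiplicative.ofAdd 1) (2 * i + 1) z.1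
    _ = (-1) ^ (i + 1) * θ z.1 := capPairing_pushChain_inv hf ht i z.1 hz
    _ = (-1) ^ (i + 1) * Θ (cls z) := by rw [hΘ]

theorem homologyInvariants_negation_of_odd {i : ℕ} (hi : Odd i) :
    Nonempty (homologyInvariants (negation n) ℤ ℤ (2 * i + 1) ≃+ ZMod n) := by
  obtain ⟨e, he⟩ := exists_barHomology_odd_equiv n i
  have htop : homologyInvariants (negation n) ℤ ℤ (2 * i + 1) = ⊤ := by
    refine eq_top_iff.2 fun x _ => (mem_homologyInvariants_negation n).2 (e.injective ?_)
    rw [he, hi.add_one.neg_one_pow, one_mul]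
  exact ⟨(addEquivOfEqTop htop).trans e⟩

theorem homologyInvariants_negation_subsingleton {i : ℕ} (hi : Even i) (hn : Odd n) :
    Subsingleton (homologyInvariants (negation n) ℤ ℤ (2 * i + 1)) := by
  obtain ⟨e, he⟩ := exists_barHomology_odd_equiv n i
  refine subsingleton_of_forall_eq 0 fun x => Subtype.ext (e.injective ?_)
  have hx := (mem_homologyInvariants_negation_of_even hi he x.1).1 x.2
  have h2 : IsUnit ((2 : ℕ) : ZMod n) := (ZMod.isUnit_iff_coprime 2 n).2 (Nat.coprime_two_left.2 hn)
  refine Eq.trans ?_ (map_zero e).symm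
  exact h2.mul_right_eq_zero.1 (by exact_mod_cast hx)

theorem homologyInvariants_negation_of_even {i k : ℕ} (hi : Even i) (hn : n = 2 * k) :
    Nonempty (homologyInvariants (negation n) ℤ ℤ (2 * i + 1) ≃+ ZMod 2) := by
  obtain ⟨e, he⟩ := exists_barHomology_odd_equiv n i
  have hmem := mem_homologyInvariants_negation_of_even hi he
  have hk : (k : ℤ) ≠ 0 := by
    rintro h
    exact NeZero.ne n (by omega)
  have h2k (a : ℤ) : 2 * ((a * k : ℤ) : ZMod n) = 0 := by
    have : (2 : ZMod n) * ((a * k : ℤ) : ZMod n) = ((n * a : ℤ) : ZMod n) := by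
      rw [hn]
      push_cast
      ring
    rw [this]
    simp
  -- The 2-torsion of `ℤ/2k` is generated by `k`.
  let π : ℤ →+ homologyInvariants (negation n) ℤ ℤ (2 * i + 1) :=
    { toFun a := ⟨e.symm ((a * k : ℤ) : ZMod n), (hmem _).2 (by rw [e.apply_symm_apply, h2k])⟩
      map_zero' := Subtype.ext (by simp)
      map_add' a b := Subtype.ext (by simp [add_mul]) }
  refine nonempty_addEquiv_zmod π (fun x => ?_) fun a => ?_
  · have hx := (hmem x.1).1 x.2
    obtain ⟨b, hb⟩ := ZMod.intCast_surjective (e x.1)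
    rw [← hb] at hx
    have hdvd : (n : ℤ) ∣ 2 * b := (ZMod.intCast_zmod_eq_zero_iff_dvd _ n).1 (by exact_mod_cast hx)
    obtain ⟨c, hc⟩ := hdvd
    refine ⟨c, Subtype.ext (e.symm_apply_eq.2 ?_)⟩
    rw [← hb]
    congr 1
    rw [hn] at hc
    push_cast at hc
    linarith
  · rw [← Subtype.coe_inj]
    change e.symm ((a * k : ℤ) : ZMod n) = 0 ↔ _
    rw [map_eq_zero_iff e.symm e.symm.injective, ZMod.intCast_zmod_eq_zero_iff_dvd, hn]
    push_cast
    exact mul_dvd_mul_iff_right hk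

end Cyclic

end InvariantChains

end

theorem theorem4p1 (n : ℕ) (hn : ¬ n ≡ 0 [MOD 4]) :
    -- the natural map is an isomorphism in every degree
    (∀ l : ℕ, Function.Bijective
      (InvariantChains.naturalMap (InvariantChains.negation n) ℤ ℤ l)) ∧
    -- degree zero
    Nonempty (InvariantChains.invariantHomology (InvariantChains.negation n) ℤ ℤ 0 ≃+ ℤ) ∧
    -- the groups for odd `n`
    (Odd n →
      (∀ k : ℕ, 1 ≤ k → Nonempty
        (InvariantChains.invariantHomology (InvariantChains.negation n) ℤ ℤ (4 * k - 1) ≃+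
          ZMod n)) ∧
      (∀ l : ℕ, 0 < l → (¬ ∃ k : ℕ, 1 ≤ k ∧ l = 4 * k - 1) →
        Subsingleton (InvariantChains.invariantHomology (InvariantChains.negation n) ℤ ℤ l))) ∧
    -- the groups for `n` twice an odd number
    (∀ k : ℕ, Odd k → n = 2 * k →
      (∀ s : ℕ, 1 ≤ s → Nonempty
        (InvariantChains.invariantHomology (InvariantChains.negation n) ℤ ℤ (4 * s - 3) ≃+
          ZMod 2)) ∧
      (∀ s : ℕ, 1 ≤ s → Nonempty
        (InvariantChains.invariantHomology (InvariantChains.negation n) ℤ ℤ (4 * s - 1) ≃+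
          ZMod (2 * k))) ∧
      (∀ l : ℕ, 0 < l → Even l →
        Subsingleton (InvariantChains.invariantHomology (InvariantChains.negation n) ℤ ℤ l))) := by
  have hn0 : NeZero n := ⟨by rintro rfl; exact hn rfl⟩
  have hbij := InvariantChains.naturalMap_negation_bijective hn
  let E (l : ℕ) : InvariantChains.invariantHomology (InvariantChains.negation n) ℤ ℤ l ≃+
      InvariantChains.homologyInvariants (InvariantChains.negation n) ℤ ℤ l :=
    AddEquiv.ofBijective (InvariantChains.naturalMap _ ℤ ℤ l).toAddMonoidHom (hbij l)
  have heven (l : ℕ) (hl : 0 < l) (he : Even l) :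
      Subsingleton (InvariantChains.invariantHomology (InvariantChains.negation n) ℤ ℤ l) := by
    have := InvariantChains.subsingleton_barHomology_even
      (InvariantChains.mem_zpowers_ofAdd_one n) hl he
    exact (E l).toEquiv.subsingleton
  have hmodd (s : ℕ) (hs : 1 ≤ s) : Nonempty
      (InvariantChains.invariantHomology (InvariantChains.negation n) ℤ ℤ (4 * s - 1) ≃+
        ZMod n) := by
    obtain ⟨j, rfl⟩ := Nat.exists_eq_add_of_le' hs
    -- Degree `2i + 1` with `i = 2j + 1` odd, where negation acts trivially.
    rw [show 4 * (j + 1) - 1 = 2 * (2 * j + 1) + 1 by omega]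
    exact (InvariantChains.homologyInvariants_negation_of_odd n
      (odd_two_mul_add_one j)).map (E _).trans
  refine ⟨hbij, ?_, fun hodd => ⟨hmodd, fun l hl hlk => ?_⟩, fun k _ hnk =>
    ⟨fun s hs => ?_, fun s hs => ?_, heven⟩⟩
  · obtain ⟨e⟩ := InvariantChains.barHomology_zero_addEquiv (Multiplicative (ZMod n))
    have htop : InvariantChains.homologyInvariants (InvariantChains.negation n) ℤ ℤ 0 = ⊤ :=
      eq_top_iff.2 fun x _ q => InvariantChains.homologyAction_zero_apply _ q x
    exact ⟨(E 0).trans ((InvariantChains.addEquivOfEqTop htop).trans e)⟩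
  · rcases Nat.even_or_odd l with he | ⟨i, rfl⟩
    · exact heven l hl he
    · have hi : Even i := by
        rw [← Nat.not_odd_iff_even]
        rintro ⟨j, rfl⟩
        exact hlk ⟨j + 1, by omega, by omega⟩
      have := InvariantChains.homologyInvariants_negation_subsingleton n hi hodd
      exact (E _).toEquiv.subsingleton
  · obtain ⟨j, rfl⟩ := Nat.exists_eq_add_of_le' hs
    rw [show 4 * (j + 1) - 3 = 2 * (2 * j) + 1 by omega]
    exact (InvariantChains.homologyInvariants_negation_of_even n
      (even_two_mul j) hnk).map (E _).trans
  · rw [← hnk]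
    exact hmodd s hs
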